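/- Let $A$ be a finite-dimensional algebra over a field $K$; modules are right modules, and $D=\mathrm{Hom}_K(-,K)$. For a module $M$ with minimal injective resolution $0\to M\to I_0\to I_1\to\cdots$, let $\Omega^{-m}(M)=\ker(I_m\to I_{m+1})$ be its $m$-th cosyzygy, and let the dominant dimension $\mathrm{domdim}(M)\in\mathbb N\cup\{\infty\}$ be the supremum of all $m$ such that $I_i$ is projective for every $i<m$. The dominant dimension of an algebra is that of its regular right module. The algebra $A$ is called Gorenstein if $\mathrm{injdim}(A)=\mathrm{projdim}(D(A))<\infty$; its Gorenstein dimension $\mathrm{Gordim}(A)$ is then $\mathrm{injdim}(A)$, and $\mathrm{Gordim}(A)=\infty$ if $A$ is not Gorenstein. Theorem. Suppose that $A$ has finite dominant dimension $n=\mathrm{domdim}(A)\ge 2$ and that $\mathrm{Gordim}(A)=\mathrm{domdim}(A)$. Let $0\to A\to I_0\to I_1\to\cdots$ be a minimal injective resolution of the right module $A$. Then the algebra $B:=\mathrm{End}_A(I_0\oplus\Omega^{-n}(A))$ has dominant dimension $n$. -/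

import Mathlib

universe u v

open CategoryTheory

section Resolutions

variable {R : Type v} [Ring R] {M : ModuleCat.{v} R}

/-- A submodule `S` of a module `N` is essential if it meets every nonzero submodule of `N`
nontrivially. -/
def IsEssentialSubmodule {N : Type*} [AddCommGroup N] [Module R N] (S : Submodule R N) : Prop :=
  ∀ L : Submodule R N, S ⊓ L = ⊥ → L = ⊥

/-- The cosyzygy `Ω⁻ⁿ(M)` computed from an injective resolution
`0 → M → I₀ → I₁ → ⋯`, as a submodule of `Iₙ`: the kernel of `Iₙ → Iₙ₊₁`. By exactness it is the
image of `M` for `n = 0`, and the image (isomorphic to the coimage, hence to the cokernel of the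
preceding map) of `Iₙ₋₁ → Iₙ` for `n ≥ 1`. -/
def cosyzygy (I : InjectiveResolution M) (n : ℕ) : Submodule R (I.cocomplex.X n) :=
  LinearMap.ker (I.cocomplex.d n (n + 1)).hom

/-- An injective resolution is minimal if every `Iₙ` is an injective hull of the cosyzygy
`Ω⁻ⁿ(M) ⊆ Iₙ`. -/
def IsMinimalResolution (I : InjectiveResolution M) : Prop :=
  ∀ n : ℕ, IsEssentialSubmodule (cosyzygy I n)

end Resolutions

/-- The dominant dimension of a (left) `R`-module `M`: the supremum of all `m ≤ ∞` such that the
terms `Iᵢ` with `i < m` of a minimal injective resolution of `M` are projective. Minimal injective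
resolutions are unique up to isomorphism, so it does not matter which one is used. -/
noncomputable def dominantDimension (R : Type v) [Ring R] (M : ModuleCat.{v} R) : ℕ∞ :=
  sSup {m : ℕ∞ | ∃ I : InjectiveResolution M, IsMinimalResolution I ∧
    ∀ i : ℕ, (i : ℕ∞) < m → Module.Projective R (I.cocomplex.X i)}

/-- The regular right module `A`, right modules over `A` being modules over `Aᵐᵒᵖ`. -/
abbrev rightRegular (A : Type v) [Ring A] : ModuleCat.{v} Aᵐᵒᵖ :=
  ModuleCat.of Aᵐᵒᵖ A

/-- The dominant dimension of an algebra: that of its regular right module. -/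
noncomputable def algebraDominantDimension (A : Type v) [Ring A] : ℕ∞ :=
  dominantDimension Aᵐᵒᵖ (rightRegular A)

section Gorenstein

variable (K : Type u) [Field K] (A : Type v) [Ring A] [Algebra K A]

/-- The underlying vector space `Hom_K(A, K)` of the right `A`-module `D(A)`. -/
def RegularDual : Type (max u v) := A →ₗ[K] K

noncomputable instance : AddCommGroup (RegularDual K A) :=
  inferInstanceAs (AddCommGroup (A →ₗ[K] K))

/-- The right `A`-module structure on `D(A)`: `(f · a)(x) = f (a x)`. -/
noncomputable instance : Module Aᵐᵒᵖ (RegularDual K A) where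
  smul a f := LinearMap.comp (show A →ₗ[K] K from f) (LinearMap.mulLeft K a.unop)
  one_smul f := LinearMap.ext fun x => congrArg (show A →ₗ[K] K from f) (one_mul x)
  mul_smul a b f := LinearMap.ext fun x =>
    congrArg (show A →ₗ[K] K from f) (mul_assoc b.unop a.unop x)
  smul_zero _ := rfl
  smul_add _ _ _ := rfl
  add_smul a b f := LinearMap.ext fun x =>
    (congrArg (show A →ₗ[K] K from f) (add_mul a.unop b.unop x)).trans (map_add _ _ _)
  zero_smul f := LinearMap.ext fun x =>
    (congrArg (show A →ₗ[K] K from f) (zero_mul x)).trans (map_zero _)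

/-- `A` is Gorenstein if `injdim(A) = projdim(D(A)) < ∞`, for right modules. -/
def IsGorensteinAlgebra : Prop :=
  injectiveDimension (rightRegular A) =
      projectiveDimension (ModuleCat.of Aᵐᵒᵖ (RegularDual K A)) ∧
    injectiveDimension (rightRegular A) < ⊤

open Classical in
/-- The Gorenstein dimension of `A`: the injective dimension of the right module `A` if `A` is
Gorenstein, and `∞` otherwise. -/
noncomputable def gorensteinDimension : WithBot ℕ∞ :=
  if IsGorensteinAlgebra K A then injectiveDimension (rightRegular A) else ⊤

end Gorenstein

/-! Write `M` for $I_0\oplus\Omega^{-n}(A)$. The point is that $M$ and $D(A)$ are direct summands of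
finite powers of each other, so $B=\mathrm{End}(M)$ is Morita equivalent to $\mathrm{End}(D(A))\cong
A$, and dominant dimension is a Morita invariant. Since $\mathrm{injdim}(A)=n$, the module
$\Omega^{-n}(A)$ is injective. So $M$ is injective and finitely generated; hence it embeds in some
$D(A)^k$ and splits off. For the other direction (`smallDual_isFiniteSummand`), let $T\subseteq
D(A)$ satisfy $\mathrm{Hom}(T,M)=0$. As $A\subseteq I_0$, there are no nonzero maps from $T$ to $A$,
hence none to a projective module, in particular none to $I_i$ for $i<n$. Dimension shifting along
the resolution gives $\mathrm{Ext}^i(T,A)=0$ for all $i\ge 0$. Because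
$\mathrm{projdim}\,D(A)<\infty$, also $\mathrm{Ext}^i(T,D(A))=0$; the case $i=0$ kills the inclusion
of $T$, so $T=0$. By the descending chain condition $D(A)$ embeds in a finite power of $M$, and it
splits off because it is injective. Morita invariance rests on `natCast_le_dominantDimension_iff`,
which replaces minimal resolutions by arbitrary projective-injective coresolutions. -/

section Coresolutions

/-! ### Projective-injective coresolutions and their closure properties. -/

variable {R : Type v} [Ring R]

theorem Function.Exact.exists_comp_eq {X Y Z W : Type*} [AddCommGroup X] [AddCommGroup Y]
    [AddCommGroup Z] [AddCommGroup W] [Module R X] [Module R Y] [Module R Z] [Module R W]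
    {f : X →ₗ[R] Y} {g : Y →ₗ[R] Z} (h : Function.Exact f g) (hg : Function.Surjective g)
    (u : Y →ₗ[R] W) (hu : u ∘ₗ f = 0) : ∃ w : Z →ₗ[R] W, w ∘ₗ g = u := by
  have hk : LinearMap.ker g ≤ LinearMap.ker u := by
    intro y hy
    obtain ⟨x, rfl⟩ := (h y).1 hy
    exact LinearMap.congr_fun hu x
  refine ⟨(LinearMap.ker g).liftQ u hk ∘ₗ (g.quotKerEquivOfSurjective hg).symm, ?_⟩
  ext y
  have : (g.quotKerEquivOfSurjective hg).symm (g y) = Submodule.Quotient.mk y := by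
    rw [LinearEquiv.symm_apply_eq]; rfl
  simp [this]

/-- `Y` is a retract, that is, up to isomorphism a direct summand, of `X`. -/
def IsRetract (R : Type*) [Ring R] (Y X : Type*) [AddCommGroup Y] [AddCommGroup X]
    [Module R Y] [Module R X] : Prop :=
  ∃ (i : Y →ₗ[R] X) (p : X →ₗ[R] Y), p ∘ₗ i = LinearMap.id

namespace IsRetract

variable {X Y : Type*} [AddCommGroup X] [AddCommGroup Y] [Module R X] [Module R Y]

theorem of_equiv (e : X ≃ₗ[R] Y) : IsRetract R X Y :=
  ⟨e, e.symm, by ext; simp⟩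

theorem projective (h : IsRetract R X Y) [Module.Projective R Y] : Module.Projective R X := by
  obtain ⟨i, p, hp⟩ := h
  exact Module.Projective.of_split i p hp

end IsRetract

/-- An injective module is a retract of every module that contains it. -/
theorem Module.Injective.isRetract {X Y : Type v} [AddCommGroup X] [AddCommGroup Y]
    [Module R X] [Module R Y] [hX : Module.Injective R X] (f : X →ₗ[R] Y)
    (hf : Function.Injective f) : IsRetract R X Y := by
  obtain ⟨h, hh⟩ := hX.out f hf LinearMap.id
  exact ⟨f, h, LinearMap.ext hh⟩

theorem IsRetract.injective {X Y : Type v} [AddCommGroup X] [AddCommGroup Y]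
    [Module R X] [Module R Y] (h : IsRetract R X Y) [hY : Module.Injective R Y] :
    Module.Injective R X := by
  obtain ⟨i, p, hp⟩ := h
  refine ⟨fun U V _ _ _ _ f hf g => ?_⟩
  obtain ⟨k, hk⟩ := hY.out f hf (i ∘ₗ g)
  refine ⟨p ∘ₗ k, fun x => ?_⟩
  have := LinearMap.congr_fun hp (g x)
  simpa [hk] using this

theorem Module.Injective.prod {X Y : Type v} [AddCommGroup X] [AddCommGroup Y]
    [Module R X] [Module R Y] [hX : Module.Injective R X] [hY : Module.Injective R Y] :
    Module.Injective R (X × Y) := by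
  refine ⟨fun U V _ _ _ _ f hf g => ?_⟩
  obtain ⟨a, ha⟩ := hX.out f hf (LinearMap.fst R X Y ∘ₗ g)
  obtain ⟨b, hb⟩ := hY.out f hf (LinearMap.snd R X Y ∘ₗ g)
  exact ⟨a.prod b, fun x => Prod.ext (ha x) (hb x)⟩

/-- The module `X` has a coresolution `0 → X → Q₀ → ⋯ → Qₘ₋₁` by modules that are both projective
and injective. -/
def HasProjInjCoresolution : ℕ → ModuleCat.{v} R → Prop
  | 0, _ => True
  | m + 1, X => ∃ (Q Z : ModuleCat.{v} R) (f : X →ₗ[R] Q) (g : Q →ₗ[R] Z),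
      Function.Injective f ∧ Function.Exact f g ∧ Function.Surjective g ∧
        Module.Projective R Q ∧ Module.Injective R Q ∧ HasProjInjCoresolution m Z

/-- Schanuel's lemma for injective modules, in a form that allows for retracts. -/
theorem isRetract_cokernel {X Y E₁ E₂ Z₁ Z₂ : Type v} [AddCommGroup X] [AddCommGroup Y]
    [AddCommGroup E₁] [AddCommGroup E₂] [AddCommGroup Z₁] [AddCommGroup Z₂] [Module R X]
    [Module R Y] [Module R E₁] [Module R E₂] [Module R Z₁] [Module R Z₂]
    (hYX : IsRetract R Y X) [h₁ : Module.Injective R E₁] [h₂ : Module.Injective R E₂]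
    {f₁ : X →ₗ[R] E₁} {g₁ : E₁ →ₗ[R] Z₁} (hf₁ : Function.Injective f₁)
    (he₁ : Function.Exact f₁ g₁) (hg₁ : Function.Surjective g₁)
    {f₂ : Y →ₗ[R] E₂} {g₂ : E₂ →ₗ[R] Z₂} (hf₂ : Function.Injective f₂)
    (he₂ : Function.Exact f₂ g₂) (hg₂ : Function.Surjective g₂) :
    IsRetract R Z₂ (E₂ × Z₁) := by
  obtain ⟨i, p, hp⟩ := hYX
  obtain ⟨a, ha⟩ := h₁.out f₂ hf₂ (f₁ ∘ₗ i)
  obtain ⟨b, hb⟩ := h₂.out f₁ hf₁ (f₂ ∘ₗ p)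
  have hp' : ∀ y, p (i y) = y := LinearMap.congr_fun hp
  simp only [LinearMap.comp_apply] at ha hb
  have z₁ : ∀ x, g₁ (f₁ x) = 0 := he₁.apply_apply_eq_zero
  have z₂ : ∀ y, g₂ (f₂ y) = 0 := he₂.apply_apply_eq_zero
  -- On the image of `f₂` the map `b ∘ a` is the identity because `p ∘ i = id`, so `id - b ∘ a`
  -- descends to `s`. Then `g₂ s + b' a' = id`, since the two contributions of `g₂ b a` cancel.
  obtain ⟨s, hs⟩ := he₂.exists_comp_eq hg₂ (LinearMap.id - b ∘ₗ a)
    (by ext y; simp [ha, hb, hp'])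
  obtain ⟨a', ha'⟩ := he₂.exists_comp_eq hg₂ (g₁ ∘ₗ a) (by ext y; simp [ha, z₁])
  obtain ⟨b', hb'⟩ := he₁.exists_comp_eq hg₁ (g₂ ∘ₗ b) (by ext y; simp [hb, z₂])
  refine ⟨s.prod a', g₂.coprod b', ?_⟩
  rw [← LinearMap.cancel_right hg₂]
  ext y
  have e1 := LinearMap.congr_fun hs y
  have e2 := LinearMap.congr_fun ha' y
  have e3 := LinearMap.congr_fun hb' (a y)
  simp only [LinearMap.comp_apply, LinearMap.sub_apply, LinearMap.id_apply] at e1 e2 e3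
  simp [e1, e2, e3]

namespace HasProjInjCoresolution

theorem prod {m : ℕ} {X Y : Type v} [AddCommGroup X] [AddCommGroup Y] [Module R X] [Module R Y]
    (hX : HasProjInjCoresolution m (ModuleCat.of R X))
    (hY : HasProjInjCoresolution m (ModuleCat.of R Y)) :
    HasProjInjCoresolution m (ModuleCat.of R (X × Y)) := by
  induction m generalizing X Y with
  | zero => trivial
  | succ m ih =>
    obtain ⟨Q, Z, f, g, hf, he, hg, _, _, hZ⟩ := hX
    obtain ⟨Q', Z', f', g', hf', he', hg', _, _, hZ'⟩ := hY
    refine ⟨ModuleCat.of R (Q × Q'), ModuleCat.of R (Z × Z'), f.prodMap f', g.prodMap g',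
      hf.prodMap hf', ?_, hg.prodMap hg', inferInstanceAs (Module.Projective R (Q × Q')),
      Module.Injective.prod, ih hZ hZ'⟩
    rintro ⟨x, y⟩
    have h1 := he x
    have h2 := he' y
    constructor
    · intro h
      obtain ⟨h3, h4⟩ := Prod.mk.inj h
      obtain ⟨a, ha⟩ := h1.1 h3
      obtain ⟨b, hb⟩ := h2.1 h4
      exact ⟨(a, b), Prod.ext ha hb⟩
    · rintro ⟨⟨a, b⟩, h⟩
      obtain ⟨h3, h4⟩ := Prod.mk.inj h
      exact Prod.ext (h1.2 ⟨a, h3⟩) (h2.2 ⟨b, h4⟩)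

theorem of_subsingleton (m : ℕ) (X : Type v) [AddCommGroup X] [Module R X] [Subsingleton X] :
    HasProjInjCoresolution m (ModuleCat.of R X) := by
  induction m with
  | zero => trivial
  | succ m ih =>
    refine ⟨ModuleCat.of R X, ModuleCat.of R X, LinearMap.id, LinearMap.id,
      fun _ _ h => h, ?_, fun x => ⟨x, rfl⟩,
      inferInstanceAs (Module.Projective R X), ?_, ih⟩
    · intro x
      exact ⟨fun _ => ⟨x, rfl⟩, fun _ => Subsingleton.elim (α := X) _ _⟩
    · exact ⟨fun U V _ _ _ _ f hf g => ⟨0, fun x => Subsingleton.elim (α := X) _ _⟩⟩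

theorem of_projective_injective (m : ℕ) (X : Type v) [AddCommGroup X] [Module R X]
    [hp : Module.Projective R X] [hi : Module.Injective R X] :
    HasProjInjCoresolution m (ModuleCat.of R X) := by
  cases m with
  | zero => trivial
  | succ m =>
    refine ⟨ModuleCat.of R X, ModuleCat.of R PUnit, LinearMap.id, 0,
      fun _ _ h => h, ?_, fun x => ⟨0, rfl⟩, hp, hi, of_subsingleton m PUnit⟩
    intro x
    exact ⟨fun _ => ⟨x, rfl⟩, fun _ => rfl⟩

/-- The retract embeds in the same `Q`; by Schanuel its cokernel is a retract of `Q × Z`, to which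
induction applies. -/
theorem of_isRetract {m : ℕ} {X Y : ModuleCat.{v} R} (hX : HasProjInjCoresolution m X)
    (h : IsRetract R Y X) : HasProjInjCoresolution m Y := by
  induction m generalizing X Y with
  | zero => trivial
  | succ m ih =>
    obtain ⟨Q, Z, f, g, hf, he, hg, hQp, hQi, hZ⟩ := hX
    have h0 := h
    obtain ⟨i, p, hp⟩ := h
    have hi : Function.Injective i := by
      intro x y hxy
      have := congrArg p hxy
      rwa [← LinearMap.comp_apply, ← LinearMap.comp_apply, hp] at this
    refine ⟨Q, ModuleCat.of R (Q ⧸ LinearMap.range (f ∘ₗ i)), f ∘ₗ i, Submodule.mkQ _,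
      hf.comp hi, LinearMap.exact_map_mkQ_range _, Submodule.mkQ_surjective _, hQp, hQi, ?_⟩
    refine ih (X := ModuleCat.of R (Q × Z)) (prod (of_projective_injective m Q) hZ)
      (isRetract_cokernel (X := X) (Y := Y) h0 hf he hg (hf.comp hi)
        (LinearMap.exact_map_mkQ_range (f ∘ₗ i)) (Submodule.mkQ_surjective _))

/-- The first step of a coresolution can be any embedding into a projective-injective module:
Schanuel compares the two cokernels. -/
theorem cokernel {m : ℕ} {X : ModuleCat.{v} R} (hX : HasProjInjCoresolution (m + 1) X)
    {E Z : Type v} [AddCommGroup E] [AddCommGroup Z] [Module R E] [Module R Z]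
    [Module.Projective R E] [Module.Injective R E] {f : X →ₗ[R] E} {g : E →ₗ[R] Z}
    (hf : Function.Injective f) (he : Function.Exact f g) (hg : Function.Surjective g) :
    HasProjInjCoresolution m (ModuleCat.of R Z) := by
  obtain ⟨Q, W, f', g', hf', he', hg', _, _, hW⟩ := hX
  exact of_isRetract (X := ModuleCat.of R (E × W)) (prod (of_projective_injective m E) hW)
    (isRetract_cokernel (IsRetract.of_equiv (LinearEquiv.refl R X)) hf' he' hg' hf he hg)

theorem pi {m k : ℕ} {X : Type v} [AddCommGroup X] [Module R X]
    (hX : HasProjInjCoresolution m (ModuleCat.of R X)) :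
    HasProjInjCoresolution m (ModuleCat.of R (Fin k → X)) := by
  induction k with
  | zero => exact of_subsingleton m _
  | succ k ih =>
    exact of_isRetract (X := ModuleCat.of R (X × (Fin k → X))) (prod hX ih)
      (IsRetract.of_equiv (Fin.consLinearEquiv R (fun _ : Fin (k + 1) => X)).symm)

end HasProjInjCoresolution

end Coresolutions

/-! ### Essential extensions and injective hulls. -/

section Hulls

variable {R : Type v} [Ring R]

theorem IsEssentialSubmodule.injective_of_ker_disjoint {N L : Type*} [AddCommGroup N]
    [AddCommGroup L] [Module R N] [Module R L] {S : Submodule R N} (hS : IsEssentialSubmodule S)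
    (f : N →ₗ[R] L) (h : ∀ x ∈ S, f x = 0 → x = 0) : Function.Injective f := by
  rw [← LinearMap.ker_eq_bot]
  apply hS
  rw [eq_bot_iff]
  rintro x ⟨hx, hx'⟩
  exact h x hx hx'

/-- A linear map defined on an essential submodule extends to an injective map into an injective
module as soon as it is injective. -/
theorem IsEssentialSubmodule.exists_injective_extension {X N L : Type v} [AddCommGroup X]
    [AddCommGroup N] [AddCommGroup L] [Module R X] [Module R N] [Module R L] {f : X →ₗ[R] N}
    (hf : Function.Injective f) (hS : IsEssentialSubmodule (LinearMap.range f))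
    [hL : Module.Injective R L] (g : X →ₗ[R] L) (hg : Function.Injective g) :
    ∃ h : N →ₗ[R] L, Function.Injective h ∧ ∀ x, h (f x) = g x := by
  obtain ⟨h, hh⟩ := hL.out f hf g
  refine ⟨h, hS.injective_of_ker_disjoint h ?_, hh⟩
  rintro _ ⟨x, rfl⟩ hx
  rw [hh] at hx
  rw [hg (hx.trans (map_zero g).symm), map_zero]

/-- Every submodule of an injective module has an injective hull inside that module. -/
theorem exists_essential_injective {N : Type v} [AddCommGroup N] [Module R N]
    [hN : Module.Injective R N] (S : Submodule R N) :
    ∃ E : Submodule R N, ∃ h : S ≤ E, Module.Injective R E ∧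
      IsEssentialSubmodule (LinearMap.range (Submodule.inclusion h)) := by
  -- `E` is maximal among the essential extensions of `S` in `N`
  let P : Set (Submodule R N) := {E | S ≤ E ∧ ∀ L ≤ E, S ⊓ L = ⊥ → L = ⊥}
  obtain ⟨E, hSE, hE⟩ := zorn_le_nonempty₀ P (by
    intro c hcP hc y hy
    refine ⟨sSup c, ⟨(hcP hy).1.trans (le_sSup hy), ?_⟩, fun z hz => le_sSup hz⟩
    intro L hL hSL
    rw [eq_bot_iff]
    intro x hx
    -- Each element lies in a single member of the chain, so essentiality can be tested there on its
    -- cyclic submodule.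
    obtain ⟨z, hz, hxz⟩ := (Submodule.mem_sSup_of_directed ⟨y, hy⟩ hc.directedOn).1 (hL hx)
    have := (hcP hz).2 (Submodule.span R {x}) (by simpa using hxz) (by
      rw [eq_bot_iff, ← hSL]
      exact inf_le_inf_left _ (by simpa using hx))
    simpa using this) S ⟨le_rfl, fun L hL h => by rwa [inf_eq_right.2 hL] at h⟩
  -- `L` is maximal among the submodules with `E ∩ L = 0`
  obtain ⟨L, -, hL⟩ := zorn_le_nonempty₀ {L : Submodule R N | E ⊓ L = ⊥} (by
    intro c hcP hc y hy
    refine ⟨sSup c, ?_, fun z hz => le_sSup hz⟩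
    change E ⊓ sSup c = ⊥
    rw [eq_bot_iff]
    rintro x ⟨hxE, hx⟩
    obtain ⟨z, hz, hxz⟩ := (Submodule.mem_sSup_of_directed ⟨y, hy⟩ hc.directedOn).1 hx
    rw [← show E ⊓ z = ⊥ from hcP hz]
    exact ⟨hxE, hxz⟩) ⊥ (by simp)
  have hEL : E ⊓ L = ⊥ := hL.prop
  let q : E →ₗ[R] N ⧸ L := L.mkQ ∘ₗ E.subtype
  have hq : Function.Injective q := by
    rw [← LinearMap.ker_eq_bot, eq_bot_iff]
    intro x hx
    have hxL : (x : N) ∈ L := by simpa [q] using hx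
    have : (x : N) ∈ E ⊓ L := ⟨x.2, hxL⟩
    rw [hEL] at this
    simpa using this
  -- A submodule of `N ⧸ L` disjoint from the image of `E` pulls back to one containing `L` and
  -- disjoint from `E`, so it equals `L` by maximality.
  have hqe : IsEssentialSubmodule (LinearMap.range q) := by
    intro T hT
    have hle : L ≤ T.comap L.mkQ := by
      intro x hx
      have : L.mkQ x = 0 := by simpa using hx
      simp [Submodule.mem_comap, this]
    have hmem : E ⊓ T.comap L.mkQ = ⊥ := by
      rw [eq_bot_iff]
      rintro x ⟨hxE, hxT⟩
      have : q ⟨x, hxE⟩ ∈ LinearMap.range q ⊓ T := ⟨⟨_, rfl⟩, hxT⟩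
      rw [hT] at this
      have h0 := hq (((Submodule.mem_bot R).1 this).trans (map_zero q).symm)
      simpa using congrArg Subtype.val h0
    have := hL.eq_of_le hmem hle
    rw [← Submodule.map_comap_eq_of_surjective L.mkQ_surjective T, ← this]
    simp
  -- The image of `h` is an essential extension of `E`, hence of `S`; maximality makes it equal to
  -- `E`. So `h` followed after `L.mkQ` retracts `N` onto `E`.
  obtain ⟨h, hh, hhq⟩ := hqe.exists_injective_extension hq E.subtype Subtype.val_injective
  have hrange : LinearMap.range h = E := by
    have hle : E ≤ LinearMap.range h := fun x hx => ⟨q ⟨x, hx⟩, hhq ⟨x, hx⟩⟩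
    refine (hE.eq_of_le ⟨hSE.trans hle, ?_⟩ hle).symm
    intro T hT hST
    have hTE : E ⊓ T = ⊥ := hE.prop.2 _ inf_le_left (by
      rw [← inf_assoc, inf_eq_left.2 hSE, hST])
    have hT' : T.comap h = ⊥ := hqe _ (by
      rw [eq_bot_iff]
      rintro _ ⟨⟨x, rfl⟩, hx⟩
      have : (x : N) ∈ E ⊓ T := ⟨x.2, by simpa [hhq] using hx⟩
      rw [hTE] at this
      have hx0 : x = 0 := by simpa using this
      simp [hx0])
    rw [← Submodule.map_comap_eq_self hT, hT', Submodule.map_bot]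
  refine ⟨E, hSE, ?_, ?_⟩
  · refine IsRetract.injective (Y := N) ⟨E.subtype,
      (h ∘ₗ L.mkQ).codRestrict E fun x => hrange ▸ LinearMap.mem_range_self h _, ?_⟩
    ext x
    exact hhq x
  · intro T hT
    have := hE.prop.2 (T.map E.subtype) (Submodule.map_subtype_le _ _) (by
      rw [eq_bot_iff]
      rintro _ ⟨hxS, x, hx, rfl⟩
      have : x ∈ LinearMap.range (Submodule.inclusion hSE) ⊓ T := ⟨⟨⟨x, hxS⟩, rfl⟩, hx⟩
      rw [hT] at this
      simpa using this)
    exact Submodule.map_injective_of_injective E.injective_subtype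
      (this.trans (Submodule.map_bot _).symm)

/-- Every module has an injective hull. -/
theorem exists_injective_hull (X : ModuleCat.{v} R) :
    ∃ (E : ModuleCat.{v} R) (f : X →ₗ[R] E), Module.Injective R E ∧ Function.Injective f ∧
      IsEssentialSubmodule (LinearMap.range f) := by
  have : Module.Injective R (Injective.under X : ModuleCat.{v} R) :=
    Module.injective_module_of_injective_object R _
      (inj := inferInstanceAs (Injective (Injective.under X)))
  have hι : Function.Injective (Injective.ι X).hom :=
    (ModuleCat.mono_iff_injective _).1 inferInstance
  obtain ⟨E, h, hE, he⟩ := exists_essential_injective (LinearMap.range (Injective.ι X).hom)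
  refine ⟨ModuleCat.of R E, Submodule.inclusion h ∘ₗ (Injective.ι X).hom.rangeRestrict, hE, ?_, ?_⟩
  · exact (Submodule.inclusion_injective h).comp fun x y hxy => hι (congrArg Subtype.val hxy)
  · rwa [LinearMap.range_comp_of_range_eq_top _ (LinearMap.range_rangeRestrict _)]

end Hulls

/-! ### Minimal injective resolutions and a resolution-free criterion for dominant dimension. -/

section MinimalResolutions

variable {R : Type v} [Ring R]

namespace CategoryTheory.InjectiveResolution

variable {X : ModuleCat.{v} R} (I : InjectiveResolution X)

/-- The coaugmentation `X → I₀` of an injective resolution. -/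
noncomputable def coaugmentation : X →ₗ[R] I.cocomplex.X 0 :=
  ModuleCat.Hom.hom (I.ι.f 0 : X ⟶ I.cocomplex.X 0)

theorem coaugmentation_injective : Function.Injective I.coaugmentation :=
  (ModuleCat.mono_iff_injective (I.ι.f 0)).1 inferInstance

theorem coaugmentation_exact :
    Function.Exact I.coaugmentation (I.cocomplex.d 0 1).hom :=
  (ShortComplex.ShortExact.moduleCat_exact_iff_function_exact _).1
    (ShortComplex.exact_of_f_is_kernel (ShortComplex.mk _ _ I.ι_f_zero_comp_complex_d)
      I.isLimitKernelFork)

theorem range_coaugmentation : LinearMap.range I.coaugmentation = cosyzygy I 0 :=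
  (LinearMap.exact_iff.1 I.coaugmentation_exact).symm

/-- The zeroth cosyzygy of `X` is `X`. -/
noncomputable def cosyzygyZeroEquiv : X ≃ₗ[R] cosyzygy I 0 :=
  (LinearEquiv.ofInjective I.coaugmentation I.coaugmentation_injective).trans
    (LinearEquiv.ofEq _ _ I.range_coaugmentation)

/-- The map `Iₙ → Ω⁻ⁿ⁻¹(X)`. -/
noncomputable def toCosyzygy (n : ℕ) : I.cocomplex.X n →ₗ[R] cosyzygy I (n + 1) :=
  (I.cocomplex.d n (n + 1)).hom.codRestrict _ fun x => by
    have := congrArg (fun f => f.hom x) (I.cocomplex.d_comp_d n (n + 1) (n + 1 + 1))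
    exact LinearMap.mem_ker.2 this

theorem toCosyzygy_surjective (n : ℕ) : Function.Surjective (I.toCosyzygy n) := by
  rintro ⟨y, hy⟩
  obtain ⟨x, hx⟩ := (ShortComplex.moduleCat_exact_iff _).1 (I.exact_succ n) y hy
  exact ⟨x, Subtype.ext hx⟩

theorem toCosyzygy_exact (n : ℕ) :
    Function.Exact (cosyzygy I n).subtype (I.toCosyzygy n) := by
  intro x
  refine ⟨fun h => ⟨⟨x, congrArg Subtype.val h⟩, rfl⟩, ?_⟩
  rintro ⟨y, rfl⟩
  exact Subtype.ext y.2

theorem moduleInjective (n : ℕ) : Module.Injective R (I.cocomplex.X n) :=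
  Module.injective_module_of_injective_object R _ (inj := I.injective n)

/-- The short exact sequence `0 → Ω⁻ⁿ(X) → Iₙ → Ω⁻ⁿ⁻¹(X) → 0`. -/
noncomputable def cosyzygyShortComplex (n : ℕ) : ShortComplex (ModuleCat.{v} R) :=
  ShortComplex.moduleCatMk (cosyzygy I n).subtype (I.toCosyzygy n)
    (I.toCosyzygy_exact n).linearMap_comp_eq_zero

theorem cosyzygyShortComplex_shortExact (n : ℕ) : (I.cosyzygyShortComplex n).ShortExact :=
  ModuleCat.shortComplex_shortExact _ (I.toCosyzygy_exact n) Subtype.val_injective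
    (I.toCosyzygy_surjective n)

theorem hasProjInjCoresolution {m : ℕ} (h : ∀ i < m, Module.Projective R (I.cocomplex.X i)) :
    HasProjInjCoresolution m X := by
  suffices H : ∀ k j, j + k ≤ m →
      HasProjInjCoresolution k (ModuleCat.of R (cosyzygy I j)) from
    (H m 0 (by simp)).of_isRetract (IsRetract.of_equiv I.cosyzygyZeroEquiv)
  intro k
  induction k with
  | zero => intros; trivial
  | succ k ih =>
    intro j hj
    exact ⟨I.cocomplex.X j, ModuleCat.of R (cosyzygy I (j + 1)), (cosyzygy I j).subtype,
      I.toCosyzygy j, Subtype.val_injective, I.toCosyzygy_exact j, I.toCosyzygy_surjective j,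
      h j (by omega), I.moduleInjective j, ih (j + 1) (by omega)⟩

end CategoryTheory.InjectiveResolution

open InjectiveResolution

/-- The hull `Iᵢ` of a cosyzygy embeds in every injective module containing that cosyzygy, so it is
a summand of the projective-injective module that begins a coresolution.
`HasProjInjCoresolution.cokernel` then passes to the next cosyzygy. -/
theorem IsMinimalResolution.projective {X : ModuleCat.{v} R} {I : InjectiveResolution X}
    (hI : IsMinimalResolution I) {m : ℕ} (hX : HasProjInjCoresolution m X) :
    ∀ i < m, Module.Projective R (I.cocomplex.X i) := by
  have key : ∀ i k, HasProjInjCoresolution (k + 1) (ModuleCat.of R (cosyzygy I i)) →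
      Module.Projective R (I.cocomplex.X i) := by
    rintro i k ⟨Q, Z, f, g, hf, he, hg, hQp, hQi, -⟩
    have hess : IsEssentialSubmodule (LinearMap.range (cosyzygy I i).subtype) := by
      rw [Submodule.range_subtype]
      exact hI i
    obtain ⟨h, hh, -⟩ := hess.exists_injective_extension Subtype.val_injective f hf
    have := I.moduleInjective i
    exact (Module.Injective.isRetract h hh).projective
  have H : ∀ i k, i + k ≤ m → HasProjInjCoresolution k (ModuleCat.of R (cosyzygy I i)) := by
    intro i
    induction i with
    | zero =>
      intro k hk
      obtain ⟨j, rfl⟩ := Nat.exists_eq_add_of_le (show k ≤ m by omega)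
      have : ∀ (j k : ℕ) {Y : ModuleCat.{v} R}, HasProjInjCoresolution (k + j) Y →
          HasProjInjCoresolution k Y := by
        intro j k
        induction k with
        | zero => intros; trivial
        | succ k ih =>
          intro Y hY
          rw [Nat.add_right_comm] at hY
          obtain ⟨Q, Z, f, g, hf, he, hg, hQp, hQi, hZ⟩ := hY
          exact ⟨Q, Z, f, g, hf, he, hg, hQp, hQi, ih hZ⟩
      exact this j k (hX.of_isRetract (IsRetract.of_equiv I.cosyzygyZeroEquiv.symm))
    | succ i ih =>
      intro k hk
      have h1 := ih (k + 1) (by omega)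
      have := key i k h1
      have := I.moduleInjective i
      exact h1.cokernel (f := (cosyzygy I i).subtype) (g := I.toCosyzygy i)
        Subtype.val_injective (I.toCosyzygy_exact i) (I.toCosyzygy_surjective i)
  intro i hi
  exact key i 0 (H i 1 (by omega))

namespace MinimalResolution

variable (X : ModuleCat.{v} R)

/-- A chosen injective hull of `X`. -/
noncomputable def hull : ModuleCat.{v} R := (exists_injective_hull X).choose

/-- The inclusion of `X` into its injective hull. -/
noncomputable def toHull : X →ₗ[R] hull X := (exists_injective_hull X).choose_spec.choose

theorem hull_injective : Module.Injective R (hull X) :=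
  (exists_injective_hull X).choose_spec.choose_spec.1

theorem toHull_injective : Function.Injective (toHull X) :=
  (exists_injective_hull X).choose_spec.choose_spec.2.1

theorem toHull_essential : IsEssentialSubmodule (LinearMap.range (toHull X)) :=
  (exists_injective_hull X).choose_spec.choose_spec.2.2

/-- The iterated cokernels of injective hulls. -/
noncomputable def syz : ℕ → ModuleCat.{v} R
  | 0 => X
  | n + 1 => ModuleCat.of R (hull (syz n) ⧸ LinearMap.range (toHull (syz n)))

/-- The projection of the hull onto the next cokernel. -/
noncomputable def toSyz (n : ℕ) : hull (syz X n) →ₗ[R] syz X (n + 1) :=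
  (LinearMap.range (toHull (syz X n))).mkQ

theorem toSyz_surjective (n : ℕ) : Function.Surjective (toSyz X n) :=
  Submodule.mkQ_surjective _

theorem toSyz_exact (n : ℕ) : Function.Exact (toHull (syz X n)) (toSyz X n) :=
  LinearMap.exact_map_mkQ_range _

/-- The differential of the minimal injective resolution. -/
noncomputable def diff (n : ℕ) : hull (syz X n) ⟶ hull (syz X (n + 1)) :=
  ModuleCat.ofHom (toHull (syz X (n + 1)) ∘ₗ toSyz X n)

theorem diff_apply_eq_zero_iff (n : ℕ) (x : hull (syz X n)) :
    (diff X n).hom x = 0 ↔ x ∈ LinearMap.range (toHull (syz X n)) := by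
  change toHull _ (toSyz X n x) = 0 ↔ _
  rw [map_eq_zero_iff _ (toHull_injective _)]
  exact toSyz_exact X n x

theorem diff_comp_diff (n : ℕ) : diff X n ≫ diff X (n + 1) = 0 := by
  ext x
  exact (diff_apply_eq_zero_iff X (n + 1) _).2 ⟨toSyz X n x, rfl⟩

/-- The minimal injective resolution, as a complex. -/
noncomputable def complex : CochainComplex (ModuleCat.{v} R) ℕ :=
  CochainComplex.of (fun n => hull (syz X n)) (diff X) (diff_comp_diff X)

theorem complex_d (n : ℕ) : (complex X).d n (n + 1) = diff X n :=
  CochainComplex.of_d (fun n => hull (syz X n)) (diff X) n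

theorem complex_exactAt (n : ℕ) : (complex X).ExactAt (n + 1) := by
  rw [HomologicalComplex.exactAt_iff' _ n (n + 1) (n + 1 + 1) (by simp) (by simp),
    ShortComplex.moduleCat_exact_iff]
  change ∀ x, ((complex X).d (n + 1) (n + 1 + 1)).hom x = 0 → ∃ y,
    ((complex X).d n (n + 1)).hom y = x
  rw [complex_d, complex_d]
  intro x hx
  obtain ⟨y, rfl⟩ := (diff_apply_eq_zero_iff X (n + 1) x).1 hx
  obtain ⟨z, rfl⟩ := toSyz_surjective X n y
  exact ⟨z, rfl⟩

theorem toHull_comp_d : (ModuleCat.ofHom (toHull X) : X ⟶ (complex X).X 0) ≫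
    (complex X).d 0 1 = 0 := by
  rw [complex_d]
  ext x
  exact (diff_apply_eq_zero_iff X 0 _).2 ⟨x, rfl⟩

theorem toHull_exact : (ShortComplex.mk (ModuleCat.ofHom (toHull X) : X ⟶ (complex X).X 0)
    ((complex X).d 0 1) (toHull_comp_d X)).Exact := by
  rw [ShortComplex.moduleCat_exact_iff]
  change ∀ x, ((complex X).d 0 (0 + 1)).hom x = 0 → ∃ y, toHull X y = x
  rw [complex_d]
  exact fun x hx => (diff_apply_eq_zero_iff X 0 x).1 hx

/-- The minimal injective resolution. -/
noncomputable def resolution : InjectiveResolution X where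
  cocomplex := complex X
  injective n := Module.injective_object_of_injective_module R _ (inj := hull_injective (syz X n))
  ι := (CochainComplex.fromSingle₀Equiv _ _).symm ⟨ModuleCat.ofHom (toHull X), toHull_comp_d X⟩
  quasiIso := ⟨fun n => by
    cases n
    -- In degree 0 the condition is exactness of `0 → X → I₀ → I₁`, transported along identity
    -- isomorphisms.
    · rw [CochainComplex.quasiIsoAt₀_iff, ShortComplex.quasiIso_iff_of_zeros]
      · refine (ShortComplex.exact_and_mono_f_iff_of_iso ?_).2
          ⟨toHull_exact X, (ModuleCat.mono_iff_injective _).2 (toHull_injective X)⟩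
        exact ShortComplex.isoMk (Iso.refl _) (Iso.refl _) (Iso.refl _)
          ((Category.id_comp _).trans ((CochainComplex.fromSingle₀Equiv_symm_apply_f_zero
            (C := complex X) (X := X) (ModuleCat.ofHom (toHull X)) (toHull_comp_d X)).symm.trans
              (Category.comp_id _).symm))
          ((Category.id_comp _).trans (Category.comp_id _).symm)
      all_goals rfl
    · rw [quasiIsoAt_iff_exactAt]
      · apply complex_exactAt
      · apply CochainComplex.exactAt_succ_single_obj⟩

theorem resolution_isMinimal : IsMinimalResolution (resolution X) := by
  intro n
  have : cosyzygy (resolution X) n = LinearMap.range (toHull (syz X n)) := by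
    ext x
    change ((complex X).d n (n + 1)).hom x = 0 ↔ _
    rw [complex_d]
    exact diff_apply_eq_zero_iff X n x
  rw [this]
  exact toHull_essential _

end MinimalResolution

theorem natCast_le_dominantDimension_iff (m : ℕ) (X : ModuleCat.{v} R) :
    (m : ℕ∞) ≤ dominantDimension R X ↔ HasProjInjCoresolution m X := by
  constructor
  · intro h
    cases m with
    | zero => trivial
    | succ m =>
      -- A bound strictly below the supremum is exceeded by some member of the set, and exceeding
      -- `m` already covers all indices up to `m`.
      have hlt : (m : ℕ∞) < dominantDimension R X :=
        lt_of_lt_of_le (by exact_mod_cast Nat.lt_succ_self m) h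
      obtain ⟨a, ⟨I, -, hI⟩, ha⟩ := lt_sSup_iff.1 hlt
      refine I.hasProjInjCoresolution fun i hi => hI i (lt_of_le_of_lt ?_ ha)
      exact_mod_cast Nat.lt_succ_iff.1 hi
  · intro h
    refine le_sSup ⟨MinimalResolution.resolution X, MinimalResolution.resolution_isMinimal X, ?_⟩
    intro i hi
    exact (MinimalResolution.resolution_isMinimal X).projective h i (by exact_mod_cast hi)

theorem dominantDimension_eq_of_forall_iff {S : Type v} [Ring S] {X : ModuleCat.{v} R}
    {Y : ModuleCat.{v} S}
    (h : ∀ m, HasProjInjCoresolution m X ↔ HasProjInjCoresolution m Y) :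
    dominantDimension R X = dominantDimension S Y := by
  refine ENat.eq_of_forall_natCast_le_iff fun m => ?_
  rw [natCast_le_dominantDimension_iff, natCast_le_dominantDimension_iff, h]

end MinimalResolutions

/-! ### Morita invariance of dominant dimension. -/

section Morita

theorem HasProjInjCoresolution.of_equivalence {R S : Type v} [Ring R] [Ring S]
    (F : ModuleCat.{v} R ≌ ModuleCat.{v} S) {m : ℕ} {X : ModuleCat.{v} R}
    (hX : HasProjInjCoresolution m X) : HasProjInjCoresolution m (F.functor.obj X) := by
  induction m generalizing X with
  | zero => trivial
  | succ m ih =>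
    obtain ⟨Q, Z, f, g, hf, he, hg, hQp, hQi, hZ⟩ := hX
    have hs : (ShortComplex.mk (ModuleCat.ofHom f) (ModuleCat.ofHom g)
        (ModuleCat.hom_ext he.linearMap_comp_eq_zero)).ShortExact :=
      ModuleCat.shortComplex_shortExact _ he hf hg
    have hs' := hs.map_of_exact F.functor
    refine ⟨F.functor.obj Q, F.functor.obj Z, (F.functor.map (ModuleCat.ofHom f)).hom,
      (F.functor.map (ModuleCat.ofHom g)).hom, hs'.moduleCat_injective_f,
      (ShortComplex.ShortExact.moduleCat_exact_iff_function_exact _).1 hs'.exact,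
      hs'.moduleCat_surjective_g, ?_, ?_, ih hZ⟩
    · exact (IsProjective.iff_projective (R := S) (F.functor.obj Q)).2
        ((F.map_projective_iff Q).2 ((IsProjective.iff_projective (R := R) Q).1 hQp))
    · exact Module.injective_module_of_injective_object S _
        (inj := (F.map_injective_iff Q).2
          (Module.injective_object_of_injective_module R Q (inj := hQi)))

/-- `N` is a direct summand of a finite power of `M`: the identity of `N` is a finite sum of maps
that factor through `M`. -/
def IsFiniteSummand (R : Type*) [Ring R] (N M : Type*) [AddCommGroup N] [AddCommGroup M]
    [Module R N] [Module R M] : Prop :=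
  ∃ (k : ℕ) (u : Fin k → (N →ₗ[R] M)) (v : Fin k → (M →ₗ[R] N)),
    ∑ j, v j ∘ₗ u j = LinearMap.id

open MulOpposite

section Sums

variable {R ι U V W : Type*} [Ring R] [AddCommGroup U] [AddCommGroup V] [AddCommGroup W]
  [Module R U] [Module R V] [Module R W]

theorem LinearMap.finset_sum_comp (s : Finset ι) (f : ι → (V →ₗ[R] W)) (g : U →ₗ[R] V) :
    (∑ i ∈ s, f i) ∘ₗ g = ∑ i ∈ s, f i ∘ₗ g := by
  ext x
  simp

theorem LinearMap.comp_finset_sum (s : Finset ι) (f : V →ₗ[R] W) (g : ι → (U →ₗ[R] V)) :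
    f ∘ₗ (∑ i ∈ s, g i) = ∑ i ∈ s, f ∘ₗ g i := by
  ext x
  simp

end Sums

section Functor

variable {R : Type*} [Ring R] (N M : Type v) [AddCommGroup N] [AddCommGroup M] [Module R N]
  [Module R M]

/-- The additive group of maps `Hom(N, M) → X` that are linear over `End(N)`, for a right
`End(N)`-module `X`. -/
def endHom (X : Type v) [AddCommGroup X] [Module (Module.End R N)ᵐᵒᵖ X] :
    AddSubgroup ((N →ₗ[R] M) →+ X) where
  carrier := {φ | ∀ (q : N →ₗ[R] M) (a : Module.End R N), φ (q ∘ₗ a) = op a • φ q}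
  add_mem' h h' q a := by simp [h q a, h' q a]
  zero_mem' q a := by simp
  neg_mem' h q a := by simp [h q a]

variable {N M}

@[ext]
theorem endHom_ext {X : Type v} [AddCommGroup X] [Module (Module.End R N)ᵐᵒᵖ X]
    {φ ψ : endHom (R := R) N M X} (h : ∀ q, φ.1 q = ψ.1 q) : φ = ψ :=
  Subtype.ext (AddMonoidHom.ext h)

/-- `End(M)` acts on the right on maps from `Hom(N, M)`. -/
instance {X : Type v} [AddCommGroup X] [Module (Module.End R N)ᵐᵒᵖ X] :
    Module (Module.End R M)ᵐᵒᵖ (endHom (R := R) N M X) where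
  smul b φ := ⟨{ toFun := fun q => φ.1 (b.unop ∘ₗ q)
                 map_zero' := by simp
                 map_add' := fun q q' => by simp [LinearMap.comp_add] },
    fun q a => by
      change φ.1 (b.unop ∘ₗ q ∘ₗ a) = _
      rw [← LinearMap.comp_assoc]
      exact φ.2 _ _⟩
  one_smul φ := endHom_ext fun q => rfl
  mul_smul b c φ := endHom_ext fun q => rfl
  smul_zero b := rfl
  smul_add b φ ψ := rfl
  add_smul b c φ := endHom_ext fun q => by
    change φ.1 ((b.unop + c.unop) ∘ₗ q) = φ.1 (b.unop ∘ₗ q) + φ.1 (c.unop ∘ₗ q)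
    rw [LinearMap.add_comp, map_add]
  zero_smul φ := endHom_ext fun q => by
    change φ.1 ((0 : Module.End R M) ∘ₗ q) = 0
    rw [LinearMap.zero_comp, map_zero]

theorem endHom_smul_apply {X : Type v} [AddCommGroup X] [Module (Module.End R N)ᵐᵒᵖ X]
    (b : (Module.End R M)ᵐᵒᵖ) (φ : endHom (R := R) N M X) (q : N →ₗ[R] M) :
    (b • φ).1 q = φ.1 (b.unop ∘ₗ q) := rfl

variable (R N M)

/-- The functor `Hom(Hom(N, M), -)` from right `End(N)`-modules to right `End(M)`-modules. -/
def endHomFunctor :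
    ModuleCat.{v} (Module.End R N)ᵐᵒᵖ ⥤ ModuleCat.{v} (Module.End R M)ᵐᵒᵖ where
  obj X := ModuleCat.of _ (endHom (R := R) N M X)
  map {X Y} f := ModuleCat.ofHom
    { toFun := fun φ => ⟨f.hom.toAddMonoidHom.comp φ.1, fun q a => by simp [φ.2 q a]⟩
      map_add' := fun φ ψ => endHom_ext fun q => by simp
      map_smul' := fun b φ => endHom_ext fun q => rfl }

variable {R N M}

/-- The unit of the Morita equivalence, on one module. -/
def endHomUnit (X : Type v) [AddCommGroup X] [Module (Module.End R N)ᵐᵒᵖ X] :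
    X →ₗ[(Module.End R N)ᵐᵒᵖ] endHom (R := R) M N (endHom (R := R) N M X) where
  toFun x := ⟨{ toFun := fun q' => ⟨{ toFun := fun q => op (q' ∘ₗ q : Module.End R N) • x
                                      map_zero' := by simp
                                      map_add' := fun q r => by
                                        rw [LinearMap.comp_add, MulOpposite.op_add, add_smul] },
                    fun q a => by
                      change op (q' ∘ₗ q ∘ₗ a : Module.End R N) • x =
                        op a • op (q' ∘ₗ q : Module.End R N) • x
                      rw [smul_smul]
                      rfl⟩
                map_zero' := endHom_ext fun q => by
                  change op ((0 : M →ₗ[R] N) ∘ₗ q : Module.End R N) • x = 0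
                  simp
                map_add' := fun q' r' => endHom_ext fun q => by
                  change op ((q' + r') ∘ₗ q : Module.End R N) • x =
                    op (q' ∘ₗ q : Module.End R N) • x + op (r' ∘ₗ q : Module.End R N) • x
                  rw [LinearMap.add_comp, MulOpposite.op_add, add_smul] },
    fun q' b => endHom_ext fun q => rfl⟩
  map_add' x y := endHom_ext fun q' => endHom_ext fun q => smul_add _ _ _
  map_smul' a x := endHom_ext fun q' => endHom_ext fun q => by
    change op (q' ∘ₗ q : Module.End R N) • a • x = op (a.unop ∘ₗ q' ∘ₗ q : Module.End R N) • x
    rw [smul_smul]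
    rfl

theorem endHomUnit_apply {X : Type v} [AddCommGroup X] [Module (Module.End R N)ᵐᵒᵖ X] (x : X)
    (q' : M →ₗ[R] N) (q : N →ₗ[R] M) :
    ((endHomUnit (M := M) X x).1 q').1 q = op (q' ∘ₗ q : Module.End R N) • x := rfl

/-- A dual basis argument: the decomposition `∑ v j ∘ u j = id` recovers the preimage of `Ψ` as `∑ Ψ
(v j) (u j)`. -/
theorem endHomUnit_bijective (h : IsFiniteSummand R N M) (X : Type v) [AddCommGroup X]
    [Module (Module.End R N)ᵐᵒᵖ X] : Function.Bijective (endHomUnit (R := R) (N := N) (M := M) X) := by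
  obtain ⟨k, u, v, huv⟩ := h
  constructor
  · rw [injective_iff_map_eq_zero]
    intro x hx
    have h1 : ∀ j, op (v j ∘ₗ u j : Module.End R N) • x = 0 := fun j => by
      rw [← endHomUnit_apply, hx]
      rfl
    calc x = op (∑ j, v j ∘ₗ u j : Module.End R N) • x := by rw [huv]; exact (one_smul _ x).symm
      _ = 0 := by rw [Finset.op_sum, Finset.sum_smul, Finset.sum_eq_zero fun j _ => h1 j]
  · intro Ψ
    refine ⟨∑ j, (Ψ.1 (v j)).1 (u j), endHom_ext fun q' => endHom_ext fun q => ?_⟩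
    rw [endHomUnit_apply, Finset.smul_sum]
    calc ∑ j, op (q' ∘ₗ q : Module.End R N) • (Ψ.1 (v j)).1 (u j)
        = ∑ j, (Ψ.1 ((v j ∘ₗ u j) ∘ₗ q')).1 q := by
          refine Finset.sum_congr rfl fun j _ => ?_
          rw [← (Ψ.1 (v j)).2, LinearMap.comp_assoc, Ψ.2 (v j) (u j ∘ₗ q'), endHom_smul_apply]
          rfl
      _ = (Ψ.1 ((∑ j, v j ∘ₗ u j) ∘ₗ q')).1 q := by
          rw [LinearMap.finset_sum_comp, map_sum]
          simp
      _ = (Ψ.1 q').1 q := by rw [huv, LinearMap.id_comp]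

/-- The unit of the Morita equivalence. -/
noncomputable def endHomUnitIso (h : IsFiniteSummand R N M) :
    𝟭 (ModuleCat.{v} (Module.End R N)ᵐᵒᵖ) ≅ endHomFunctor R N M ⋙ endHomFunctor R M N :=
  NatIso.ofComponents
    (fun X => (LinearEquiv.ofBijective (endHomUnit (N := N) (M := M) X)
      (endHomUnit_bijective h X)).toModuleIso)
    (fun {X Y} f => by
      ext x
      refine endHom_ext fun q' => endHom_ext fun q => ?_
      exact (map_smul f.hom (op (q' ∘ₗ q : Module.End R N)) x).symm)

/-- Modules with the same finite summands of powers have Morita equivalent endomorphism rings. -/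
noncomputable def endEquivalence (h : IsFiniteSummand R N M) (h' : IsFiniteSummand R M N) :
    ModuleCat.{v} (Module.End R N)ᵐᵒᵖ ≌ ModuleCat.{v} (Module.End R M)ᵐᵒᵖ :=
  CategoryTheory.Equivalence.mk (endHomFunctor R N M) (endHomFunctor R M N) (endHomUnitIso h)
    (endHomUnitIso h').symm

/-- `End(M)` is, up to the Morita equivalence, a finite summand of a power of `End(N)`. -/
theorem isRetract_endHom (h : IsFiniteSummand R M N) :
    ∃ k, IsRetract (Module.End R M)ᵐᵒᵖ (Module.End R M)
      (Fin k → endHom (R := R) N M (Module.End R N)) := by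
  obtain ⟨k, u, v, huv⟩ := h
  have hφ : ∀ (φ : endHom (R := R) N M (Module.End R N)) (q : N →ₗ[R] M) (a : Module.End R N),
      φ.1 (q ∘ₗ a) = φ.1 q ∘ₗ a := fun φ q a => φ.2 q a
  -- `w` identifies the image of `End(N)` under the functor with `Hom(M, N)`: it sends composition
  -- with `q'` back to `q'`.
  let w : endHom (R := R) N M (Module.End R N) → (M →ₗ[R] N) := fun φ => ∑ i, φ.1 (v i) ∘ₗ u i
  have hw : ∀ φ (b : Module.End R M), w (op b • φ) = w φ ∘ₗ b := by
    intro φ b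
    calc ∑ i, φ.1 (b ∘ₗ v i) ∘ₗ u i
        = ∑ i, ∑ l, φ.1 (v l) ∘ₗ u l ∘ₗ b ∘ₗ v i ∘ₗ u i := by
          refine Finset.sum_congr rfl fun i _ => ?_
          -- `φ` is only linear over `End(N)`, so `b` must first be turned into endomorphisms of `N`
          -- by inserting the identity of `M`.
          have h1 : b ∘ₗ v i = ∑ l, v l ∘ₗ (u l ∘ₗ b ∘ₗ v i) := by
            calc b ∘ₗ v i = (∑ l, v l ∘ₗ u l) ∘ₗ (b ∘ₗ v i) := by rw [huv, LinearMap.id_comp]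
              _ = _ := by rw [LinearMap.finset_sum_comp]; rfl
          rw [h1, map_sum, LinearMap.finset_sum_comp]
          exact Finset.sum_congr rfl fun l _ => by rw [hφ]; rfl
      _ = ∑ l, φ.1 (v l) ∘ₗ u l ∘ₗ b ∘ₗ ∑ i, v i ∘ₗ u i := by
          rw [Finset.sum_comm]
          simp only [LinearMap.comp_finset_sum]
      _ = w φ ∘ₗ b := by
          rw [huv, LinearMap.comp_id, LinearMap.finset_sum_comp]
          rfl
  have hw' : ∀ φ ψ, w (φ + ψ) = w φ + w ψ := by
    intro φ ψ
    rw [← Finset.sum_add_distrib]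
    rfl
  refine ⟨k, LinearMap.pi fun j =>
    { toFun := fun b => ⟨{ toFun := fun q => u j ∘ₗ b ∘ₗ q
                           map_zero' := by simp
                           map_add' := fun q r => by simp [LinearMap.comp_add] },
        fun q a => rfl⟩
      map_add' := fun b c => endHom_ext fun q => by
        change u j ∘ₗ (b + c) ∘ₗ q = u j ∘ₗ b ∘ₗ q + u j ∘ₗ c ∘ₗ q
        rw [LinearMap.add_comp, LinearMap.comp_add]
      map_smul' := fun b c => rfl },
    { toFun := fun φ => ∑ j, v j ∘ₗ w (φ j)
      map_add' := fun φ ψ => by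
        simp only [Pi.add_apply, hw', LinearMap.comp_add, Finset.sum_add_distrib]
      map_smul' := fun b φ => by
        change ∑ j, v j ∘ₗ w (op b.unop • φ j) = (∑ j, v j ∘ₗ w (φ j)) ∘ₗ b.unop
        simp only [hw, LinearMap.finset_sum_comp]
        rfl }, ?_⟩
  refine LinearMap.ext fun b => ?_
  change ∑ j, v j ∘ₗ ∑ i, (u j ∘ₗ b ∘ₗ v i) ∘ₗ u i = b
  have h1 : ∀ j, ∑ i, (u j ∘ₗ b ∘ₗ v i) ∘ₗ u i = u j ∘ₗ b := fun j => by
    calc _ = u j ∘ₗ b ∘ₗ ∑ i, v i ∘ₗ u i := by simp only [LinearMap.comp_finset_sum]; rfl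
      _ = _ := by rw [huv, LinearMap.comp_id]
  simp only [h1]
  calc _ = (∑ j, v j ∘ₗ u j) ∘ₗ b := by rw [LinearMap.finset_sum_comp]; rfl
    _ = b := by rw [huv, LinearMap.id_comp]

theorem HasProjInjCoresolution.moduleEnd (h : IsFiniteSummand R N M) (h' : IsFiniteSummand R M N)
    {m : ℕ} (hN : HasProjInjCoresolution m (rightRegular (Module.End R N))) :
    HasProjInjCoresolution m (rightRegular (Module.End R M)) := by
  obtain ⟨k, hk⟩ := isRetract_endHom h'
  have h1 := hN.of_equivalence (endEquivalence h h')
  have h2 : HasProjInjCoresolution m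
      (ModuleCat.of (Module.End R M)ᵐᵒᵖ (endHom (R := R) N M (Module.End R N))) := h1
  exact (h2.pi (k := k)).of_isRetract hk

theorem algebraDominantDimension_moduleEnd (h : IsFiniteSummand R N M)
    (h' : IsFiniteSummand R M N) :
    algebraDominantDimension (Module.End R M) = algebraDominantDimension (Module.End R N) :=
  dominantDimension_eq_of_forall_iff fun _ =>
    ⟨fun H => H.moduleEnd h' h, fun H => H.moduleEnd h h'⟩

end Functor

theorem HasProjInjCoresolution.of_ringEquiv {A B : Type v} [Ring A] [Ring B] (e : A ≃+* B) {m : ℕ}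
    (hA : HasProjInjCoresolution m (rightRegular A)) :
    HasProjInjCoresolution m (rightRegular B) := by
  have h := hA.of_equivalence (ModuleCat.restrictScalarsEquivalenceOfRingEquiv e.symm.op)
  refine h.of_isRetract (IsRetract.of_equiv ?_)
  exact
    { e.symm with
      map_smul' := fun b x => by
        change e.symm (x * b.unop) = e.symm x * e.symm b.unop
        exact map_mul _ _ _ }

theorem algebraDominantDimension_eq_of_ringEquiv {A B : Type v} [Ring A] [Ring B] (e : A ≃+* B) :
    algebraDominantDimension A = algebraDominantDimension B :=
  dominantDimension_eq_of_forall_iff fun _ =>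
    ⟨fun H => H.of_ringEquiv e, fun H => H.of_ringEquiv e.symm⟩

end Morita

/-! ### The dual $D(A)$: injectivity, cogeneration and endomorphism ring. -/

section Dual

open MulOpposite

variable {K : Type u} [Field K] {A : Type v} [Ring A] [Algebra K A]

namespace RegularDual

noncomputable instance : Module K (RegularDual K A) :=
  inferInstanceAs (Module K (A →ₗ[K] K))

/-- The functional underlying an element of `D(A)`. -/
noncomputable def toLin : RegularDual K A ≃ₗ[K] (A →ₗ[K] K) := LinearEquiv.refl K (A →ₗ[K] K)

theorem ext {f g : RegularDual K A} (h : ∀ x, toLin f x = toLin g x) : f = g :=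
  toLin.injective (LinearMap.ext h)

theorem toLin_smul (a : Aᵐᵒᵖ) (f : RegularDual K A) (x : A) :
    toLin (a • f) x = toLin f (a.unop * x) := rfl

theorem toLin_smul_one (a : A) (f : RegularDual K A) : toLin (op a • f) 1 = toLin f a := by
  rw [toLin_smul, unop_op, mul_one]

instance : IsScalarTower K Aᵐᵒᵖ (RegularDual K A) :=
  ⟨fun c a f => ext fun x => by
    rw [toLin_smul, unop_smul, smul_mul_assoc, map_smul, map_smul]
    rfl⟩

instance [FiniteDimensional K A] : Module.Finite K (RegularDual K A) :=
  inferInstanceAs (Module.Finite K (A →ₗ[K] K))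

instance [FiniteDimensional K A] : Module.Finite Aᵐᵒᵖ (RegularDual K A) :=
  Module.Finite.of_restrictScalars_finite K Aᵐᵒᵖ _

section Adjunction

variable {X : Type*} [AddCommGroup X] [Module Aᵐᵒᵖ X] [Module K X] [IsScalarTower K Aᵐᵒᵖ X]

/-- The map into `D(A)` that corresponds to a functional. -/
noncomputable def ofFunctional (l : X →ₗ[K] K) : X →ₗ[Aᵐᵒᵖ] RegularDual K A where
  toFun x := toLin.symm
    { toFun := fun a => l (op a • x)
      map_add' := fun a b => by rw [MulOpposite.op_add, add_smul, map_add]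
      map_smul' := fun c a => by rw [op_smul, smul_assoc, map_smul, RingHom.id_apply] }
  map_add' x y := ext fun a => by
    change l (op a • (x + y)) = l (op a • x) + l (op a • y)
    rw [smul_add, map_add]
  map_smul' b x := ext fun a => by
    change l (op a • b • x) = l (op (b.unop * a) • x)
    rw [smul_smul]
    rfl

theorem toLin_ofFunctional (l : X →ₗ[K] K) (x : X) (a : A) :
    toLin (ofFunctional l x) a = l (op a • x) := rfl

/-- The functional that corresponds to a map into `D(A)`. -/
noncomputable def functional (f : X →ₗ[Aᵐᵒᵖ] RegularDual K A) : X →ₗ[K] K where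
  toFun x := toLin (f x) 1
  map_add' x y := by simp
  map_smul' c x := by
    rw [← one_smul Aᵐᵒᵖ x, ← smul_assoc, map_smul, toLin_smul, unop_smul, smul_mul_assoc, map_smul]
    simp

theorem functional_smul (f : X →ₗ[Aᵐᵒᵖ] RegularDual K A) (a : A) (x : X) :
    functional f (op a • x) = toLin (f x) a := by
  change toLin (f (op a • x)) 1 = _
  rw [map_smul, toLin_smul_one]

variable {Y : Type*} [AddCommGroup Y] [Module Aᵐᵒᵖ Y] [Module K Y] [IsScalarTower K Aᵐᵒᵖ Y]

/-- Maps into $D(A)$ correspond to functionals, and functionals extend over a field. -/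
theorem exists_extension (f : X →ₗ[Aᵐᵒᵖ] Y) (hf : Function.Injective f)
    (g : X →ₗ[Aᵐᵒᵖ] RegularDual K A) : ∃ h : Y →ₗ[Aᵐᵒᵖ] RegularDual K A, ∀ x, h (f x) = g x := by
  let f' : X →ₗ[K] Y := f.restrictScalars K
  obtain ⟨r, hr⟩ := LinearMap.exists_leftInverse_of_injective f' (LinearMap.ker_eq_bot.2 hf)
  refine ⟨ofFunctional (functional g ∘ₗ r), fun x => ext fun a => ?_⟩
  rw [toLin_ofFunctional, ← map_smul, LinearMap.comp_apply, ← functional_smul]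
  exact congrArg _ (LinearMap.congr_fun hr (op a • x))

theorem exists_embedding [Module.Finite K X] :
    ∃ (k : ℕ) (f : X →ₗ[Aᵐᵒᵖ] (Fin k → RegularDual K A)), Function.Injective f := by
  let b := Module.finBasis K X
  refine ⟨_, LinearMap.pi fun i => ofFunctional (b.coord i), ?_⟩
  rw [injective_iff_map_eq_zero]
  intro x hx
  refine b.ext_elem fun i => ?_
  have h1 := congrArg (fun f => toLin f 1) (congrFun hx i)
  simpa [toLin_ofFunctional] using h1

end Adjunction

/-- `A` acts on the left on `D(A)`. -/
noncomputable def leftMul : A →+* Module.End Aᵐᵒᵖ (RegularDual K A) where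
  toFun a :=
    { toFun := fun f => toLin.symm (toLin f ∘ₗ LinearMap.mulRight K a)
      map_add' := fun _ _ => rfl
      map_smul' := fun _ f => ext fun _ => congrArg (toLin f) (mul_assoc _ _ _).symm }
  map_one' := LinearMap.ext fun f => ext fun x => congrArg (toLin f) (mul_one x)
  map_mul' a b := LinearMap.ext fun f => ext fun x => congrArg (toLin f) (mul_assoc x a b).symm
  map_zero' := LinearMap.ext fun f => ext fun x =>
    (congrArg (toLin f) (mul_zero x)).trans (map_zero _)
  map_add' a b := LinearMap.ext fun f => ext fun x =>
    (congrArg (toLin f) (mul_add x a b)).trans (map_add _ _ _)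

theorem toLin_leftMul (a : A) (f : RegularDual K A) (x : A) :
    toLin (leftMul a f) x = toLin f (x * a) := rfl

/-- An endomorphism `φ` is determined by the functional `f ↦ φ f 1` on $D(A)$, which by reflexivity
of `A` is evaluation at some `a`. -/
theorem leftMul_bijective [FiniteDimensional K A] :
    Function.Bijective (leftMul : A →+* Module.End Aᵐᵒᵖ (RegularDual K A)) := by
  constructor
  · rw [injective_iff_map_eq_zero]
    intro a ha
    rw [← Module.forall_dual_apply_eq_zero_iff K]
    intro l
    have := toLin_leftMul a (toLin.symm l) 1
    rw [ha, one_mul] at this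
    exact this.symm
  · intro φ
    let a : A := (Module.evalEquiv K A).symm (functional φ ∘ₗ toLin.symm.toLinearMap)
    have ha : ∀ f : RegularDual K A, toLin f a = toLin (φ f) 1 := fun f => by
      have := Module.apply_evalEquiv_symm_apply K A (toLin f)
        (functional φ ∘ₗ toLin.symm.toLinearMap)
      exact this
    refine ⟨a, LinearMap.ext fun f => ext fun x => ?_⟩
    rw [toLin_leftMul, ← toLin_smul_one x (φ f), ← map_smul, ← ha, toLin_smul, unop_op]

variable (K A)

/-- The endomorphism ring of the right module `D(A)` is `A`. -/
noncomputable def endRingEquiv [FiniteDimensional K A] :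
    A ≃+* Module.End Aᵐᵒᵖ (RegularDual K A) :=
  RingEquiv.ofBijective leftMul leftMul_bijective

end RegularDual

end Dual

/-! ### Embeddings into finite powers. -/

section FiniteSummand

variable {R : Type v} [Ring R]

theorem IsRetract.isFiniteSummand {N M : Type*} [AddCommGroup N] [AddCommGroup M] [Module R N]
    [Module R M] {k : ℕ} (h : IsRetract R N (Fin k → M)) : IsFiniteSummand R N M := by
  obtain ⟨i, p, hp⟩ := h
  refine ⟨k, fun j => LinearMap.proj j ∘ₗ i,
    fun j => p ∘ₗ LinearMap.single R (fun _ => M) j, ?_⟩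
  rw [← hp]
  ext x
  simp only [LinearMap.sum_apply, LinearMap.comp_apply, ← map_sum]
  congr 1
  ext j
  simp

/-- A module of finite length all of whose nonzero submodules map nontrivially to the injective
module `M` embeds in a power of `M`. -/
theorem exists_embedding_pi {N M : Type v} [AddCommGroup N] [AddCommGroup M] [Module R N]
    [Module R M] [IsArtinian R N] [hM : Module.Injective R M]
    (h : ∀ T : Submodule R N, (∀ g : T →ₗ[R] M, g = 0) → T = ⊥) :
    ∃ (k : ℕ) (f : N →ₗ[R] (Fin k → M)), Function.Injective f := by
  let P : Set (Submodule R N) := {T | ∃ (k : ℕ) (f : N →ₗ[R] (Fin k → M)), LinearMap.ker f = T}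
  -- Take a minimal kernel: a nonzero map from it to `M` would extend to `N` and, as an extra
  -- coordinate, shrink it.
  obtain ⟨T, ⟨k, f, rfl⟩, hT⟩ := IsArtinian.set_has_minimal P ⟨_, 0, 0, rfl⟩
  refine ⟨k, f, LinearMap.ker_eq_bot.1 (h _ fun g => ?_)⟩
  obtain ⟨g', hg'⟩ := hM.out (LinearMap.ker f).subtype Subtype.val_injective g
  let f' : N →ₗ[R] (Fin (k + 1) → M) :=
    (Fin.consLinearEquiv R (fun _ : Fin (k + 1) => M)).toLinearMap ∘ₗ g'.prod f
  have hker : ∀ x, f' x = 0 ↔ g' x = 0 ∧ f x = 0 := fun x => by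
    simp only [f', LinearMap.comp_apply, LinearEquiv.coe_coe, LinearEquiv.map_eq_zero_iff]
    exact Prod.mk_eq_zero
  have hle : LinearMap.ker f' ≤ LinearMap.ker f := fun x hx => ((hker x).1 hx).2
  have := eq_of_le_of_not_lt hle (hT _ ⟨_, f', rfl⟩)
  ext x
  have hx : (x : N) ∈ LinearMap.ker f' := by
    rw [this]
    exact x.2
  rw [← hg']
  exact ((hker x).1 hx).1

end FiniteSummand

/-! ### Vanishing of Ext and dimension shifting. -/

section ExtVanishing

open Abelian

variable {R : Type v} [Ring R]

/-- All extension groups `Extⁱ(Y, X)`, `i ≥ 0`, vanish. -/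
def ExtVanishes (Y X : ModuleCat.{v} R) : Prop :=
  ∀ (i : ℕ) (e : Ext Y X i), e = 0

namespace ExtVanishes

variable {Y : ModuleCat.{v} R}

theorem X₁ {S : ShortComplex (ModuleCat.{v} R)} (hS : S.ShortExact) (h₂ : ExtVanishes Y S.X₂)
    (h₃ : ExtVanishes Y S.X₃) : ExtVanishes Y S.X₁ := by
  have := hS.mono_f
  rintro (_ | i) e
  · apply Ext.postcomp_mk₀_injective_of_mono Y S.f
    exact (h₂ _ _).trans (h₂ _ _).symm
  · obtain ⟨x, rfl⟩ := Ext.covariant_sequence_exact₁ Y hS e (h₂ _ _) rfl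
    rw [h₃ _ x, Ext.zero_comp]

theorem X₃ {S : ShortComplex (ModuleCat.{v} R)} (hS : S.ShortExact) (h₁ : ExtVanishes Y S.X₁)
    (h₂ : ExtVanishes Y S.X₂) : ExtVanishes Y S.X₃ := by
  intro i e
  obtain ⟨x, rfl⟩ := Ext.covariant_sequence_exact₃ Y hS e rfl (h₁ _ _)
  rw [h₂ _ x, Ext.zero_comp]

theorem of_injective {X : ModuleCat.{v} R} [Module.Injective R X]
    (h : ∀ f : Y →ₗ[R] X, f = 0) : ExtVanishes Y X := by
  have : Injective X := Module.injective_object_of_injective_module R X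
  rintro (_ | i) e
  · obtain ⟨f, rfl⟩ := (Ext.mk₀_bijective Y X).2 e
    rw [Ext.mk₀_eq_zero_iff]
    exact ModuleCat.hom_ext (h f.hom)
  · exact e.eq_zero_of_injective

theorem hom_eq_zero {X : ModuleCat.{v} R} (h : ExtVanishes Y X) (f : Y →ₗ[R] X) : f = 0 := by
  have := (Ext.mk₀_eq_zero_iff (ModuleCat.ofHom f)).1 (h 0 _)
  exact congrArg ModuleCat.Hom.hom this

theorem of_isFiniteSummand {X X' : ModuleCat.{v} R} (h : ExtVanishes Y X)
    (hX : IsFiniteSummand R X' X) : ExtVanishes Y X' := by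
  obtain ⟨k, u, v, huv⟩ := hX
  intro i e
  have hid : 𝟙 X' = ∑ j, ModuleCat.ofHom (u j) ≫ ModuleCat.ofHom (v j) := by
    refine ModuleCat.hom_ext ?_
    rw [ModuleCat.hom_sum, ModuleCat.hom_id, ← huv]
    rfl
  rw [← e.comp_mk₀_id, hid, Ext.mk₀_sum, Ext.comp_sum, Finset.sum_eq_zero]
  intro j _
  rw [← Ext.mk₀_comp_mk₀, ← Ext.comp_assoc_of_second_deg_zero, h _ (e.comp _ _), Ext.zero_comp]

theorem of_linearEquiv {X X' : ModuleCat.{v} R} (h : ExtVanishes Y X) (e : X' ≃ₗ[R] X) :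
    ExtVanishes Y X' :=
  h.of_isFiniteSummand ⟨1, fun _ => e, fun _ => e.symm, by ext; simp⟩

/-- Vanishing passes from the regular module to finitely generated modules of finite projective
dimension. -/
theorem of_hasProjectiveDimensionLT [IsNoetherianRing R] (hR : ExtVanishes Y (ModuleCat.of R R))
    {d : ℕ} {X : ModuleCat.{v} R} [Module.Finite R X] (hX : HasProjectiveDimensionLT X (d + 1)) :
    ExtVanishes Y X := by
  induction d generalizing X with
  | zero =>
    have hp : Module.Projective R X :=
      (IsProjective.iff_projective (R := R) X).2 (projective_iff_hasProjectiveDimensionLT_one.2 hX)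
    obtain ⟨k, f, hf⟩ := Module.Finite.exists_fin' R X
    obtain ⟨s, hs⟩ := Module.projective_lifting_property f LinearMap.id hf
    exact hR.of_isFiniteSummand (IsRetract.isFiniteSummand (k := k) ⟨s, f, hs⟩)
  | succ d ih =>
    obtain ⟨k, f, hf⟩ := Module.Finite.exists_fin' R X
    have hS : (ShortComplex.moduleCatMk (LinearMap.ker f).subtype f
        (LinearMap.exact_subtype_ker_map f).linearMap_comp_eq_zero).ShortExact :=
      ModuleCat.shortComplex_shortExact _ (LinearMap.exact_subtype_ker_map f)
        Subtype.val_injective hf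
    have hp : Projective (ModuleCat.of R (Fin k → R)) :=
      (IsProjective.iff_projective (R := R) (Fin k → R)).1 inferInstance
    -- The syzygy has a projective dimension bound one smaller, and it stays finitely generated
    -- because `R` is Noetherian.
    have hK := (hS.hasProjectiveDimensionLT_X₃_iff d hp).1 hX
    have : Module.Finite R (ModuleCat.of R (LinearMap.ker f)) :=
      inferInstanceAs (Module.Finite R (LinearMap.ker f))
    have hF : ExtVanishes Y (ModuleCat.of R (Fin k → R)) :=
      hR.of_isFiniteSummand (IsRetract.isFiniteSummand (k := k)
        (IsRetract.of_equiv (LinearEquiv.refl R (Fin k → R))))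
    exact X₃ hS (ih (X := ModuleCat.of R (LinearMap.ker f)) hK) hF

/-- Vanishing is clear for the injective module `Ω⁻ⁿ(X)` and descends one cosyzygy at a time to
`Ω⁰(X) ≅ X`. -/
theorem of_injectiveResolution {X : ModuleCat.{v} R} (I : InjectiveResolution X) {n : ℕ}
    [hC : Module.Injective R (cosyzygy I n)] (hYC : ∀ f : Y →ₗ[R] cosyzygy I n, f = 0)
    (hYI : ∀ i < n, ∀ f : Y →ₗ[R] I.cocomplex.X i, f = 0) : ExtVanishes Y X := by
  have hn : ExtVanishes Y (ModuleCat.of R (cosyzygy I n)) := by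
    have : Module.Injective R (ModuleCat.of R (cosyzygy I n)) := hC
    exact of_injective hYC
  have key : ∀ j ≤ n, ExtVanishes Y (ModuleCat.of R (cosyzygy I (n - j))) := by
    intro j
    induction j with
    | zero => exact fun _ => hn
    | succ j ih =>
      intro hj
      have h1 := ih (by omega)
      have := I.moduleInjective (n - (j + 1))
      have h2 : ExtVanishes Y (I.cocomplex.X (n - (j + 1))) := of_injective (hYI _ (by omega))
      rw [show n - j = n - (j + 1) + 1 by omega] at h1
      exact X₁ (I.cosyzygyShortComplex_shortExact (n - (j + 1))) h2 h1
  have h0 := key n le_rfl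
  rw [Nat.sub_self] at h0
  exact h0.of_linearEquiv I.cosyzygyZeroEquiv

end ExtVanishes

/-- Each cosyzygy lowers the bound on the injective dimension by one. -/
theorem CategoryTheory.InjectiveResolution.cosyzygy_injective {X : ModuleCat.{v} R}
    (I : InjectiveResolution X) {n : ℕ} (h : HasInjectiveDimensionLT X (n + 1)) :
    Module.Injective R (cosyzygy I n) := by
  have key : ∀ j k, j + k = n → HasInjectiveDimensionLT (ModuleCat.of R (cosyzygy I j)) (k + 1) := by
    intro j
    induction j with
    | zero =>
      rintro k hk
      obtain rfl : k = n := by omega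
      exact hasInjectiveDimensionLT_of_iso
        (LinearEquiv.toModuleIso (X₂ := cosyzygy I 0) I.cosyzygyZeroEquiv) _
    | succ j ih =>
      intro k hk
      exact ((I.cosyzygyShortComplex_shortExact j).hasInjectiveDimensionLT_X₃_iff k
        (I.injective j)).2 (ih (k + 1) (by omega))
  have := key n 0 rfl
  exact Module.injective_module_of_injective_object R _
    (inj := inferInstanceAs (Injective (ModuleCat.of R (cosyzygy I n))))

end ExtVanishing

/-! ### A copy of $D(A)$ in the universe of `A`, where the injectivity and Ext arguments take place.
-/

section SmallDual

open MulOpposite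

variable (K : Type u) [Field K] (A : Type v) [Ring A] [Algebra K A]

theorem isScalarTower_compHom (X : Type*) [AddCommGroup X] [Module Aᵐᵒᵖ X] :
    letI := Module.compHom X (algebraMap K Aᵐᵒᵖ)
    IsScalarTower K Aᵐᵒᵖ X := by
  let := Module.compHom X (algebraMap K Aᵐᵒᵖ)
  refine ⟨fun c r x => ?_⟩
  rw [Algebra.smul_def, mul_smul]
  rfl

variable [FiniteDimensional K A]

instance : Small.{v} (RegularDual K A) :=
  Module.Finite.small.{v} Aᵐᵒᵖ (RegularDual K A)

/-- A copy of the right module `D(A)` in the universe of `A`. -/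
abbrev SmallDual : Type v := Shrink.{v} (RegularDual K A)

/-- The module `D(A)` and its copy in the universe of `A`. -/
noncomputable def smallDualEquiv : SmallDual K A ≃ₗ[Aᵐᵒᵖ] RegularDual K A :=
  Shrink.linearEquiv Aᵐᵒᵖ (RegularDual K A)

instance : Module.Finite Aᵐᵒᵖ (SmallDual K A) :=
  Module.Finite.equiv (smallDualEquiv K A).symm

instance smallDual_injective : Module.Injective Aᵐᵒᵖ (SmallDual K A) := by
  refine ⟨fun X Y _ _ _ _ f hf g => ?_⟩
  let := Module.compHom X (algebraMap K Aᵐᵒᵖ)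
  let := Module.compHom Y (algebraMap K Aᵐᵒᵖ)
  have := isScalarTower_compHom K A X
  have := isScalarTower_compHom K A Y
  obtain ⟨h, hh⟩ := RegularDual.exists_extension f hf ((smallDualEquiv K A).toLinearMap ∘ₗ g)
  refine ⟨(smallDualEquiv K A).symm.toLinearMap ∘ₗ h, fun x => ?_⟩
  simp [hh]

theorem exists_embedding_smallDual (X : Type v) [AddCommGroup X] [Module Aᵐᵒᵖ X]
    [Module.Finite Aᵐᵒᵖ X] :
    ∃ (k : ℕ) (f : X →ₗ[Aᵐᵒᵖ] (Fin k → SmallDual K A)), Function.Injective f := by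
  let := Module.compHom X (algebraMap K Aᵐᵒᵖ)
  have := isScalarTower_compHom K A X
  have : Module.Finite K X := Module.Finite.trans Aᵐᵒᵖ X
  obtain ⟨k, f, hf⟩ := RegularDual.exists_embedding (K := K) (A := A) (X := X)
  let e : (Fin k → RegularDual K A) ≃ₗ[Aᵐᵒᵖ] (Fin k → SmallDual K A) :=
    LinearEquiv.piCongrRight fun _ => (smallDualEquiv K A).symm
  exact ⟨k, e.toLinearMap ∘ₗ f, e.injective.comp hf⟩

/-- The endomorphism ring of `D(A)` is `A`. -/
noncomputable def smallDualEndEquiv : A ≃+* Module.End Aᵐᵒᵖ (SmallDual K A) :=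
  (RegularDual.endRingEquiv K A).trans (smallDualEquiv K A).symm.conjRingEquiv

/-- The right regular module, as a module over the opposite ring. -/
def opRegularEquiv : Aᵐᵒᵖ ≃ₗ[Aᵐᵒᵖ] A where
  toFun := unop
  invFun := op
  map_add' _ _ := rfl
  map_smul' _ _ := rfl

end SmallDual

/-! ### Finite generation of minimal resolutions. -/

section Finiteness

/-- An essential extension of a finitely generated module is finitely generated. -/
theorem finite_of_essential (K : Type u) [Field K] {A : Type v} [Ring A] [Algebra K A]
    [FiniteDimensional K A] {X E : Type v} [AddCommGroup X] [Module Aᵐᵒᵖ X] [AddCommGroup E]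
    [Module Aᵐᵒᵖ E] [Module.Finite Aᵐᵒᵖ X] {f : X →ₗ[Aᵐᵒᵖ] E} (hf : Function.Injective f)
    (h : IsEssentialSubmodule (LinearMap.range f)) : Module.Finite Aᵐᵒᵖ E := by
  have : IsNoetherianRing Aᵐᵒᵖ := IsNoetherianRing.of_finite K Aᵐᵒᵖ
  obtain ⟨k, g, hg⟩ := exists_embedding_smallDual K A X
  -- Essentiality makes the extension to `E` injective, so `E` sits inside a finitely generated
  -- module over a Noetherian ring.
  obtain ⟨g', hg', -⟩ := h.exists_injective_extension hf g hg
  exact Module.Finite.of_injective g' hg'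

theorem IsMinimalResolution.finite (K : Type u) [Field K] {A : Type v} [Ring A] [Algebra K A]
    [FiniteDimensional K A] {X : ModuleCat.{v} Aᵐᵒᵖ} [hX : Module.Finite Aᵐᵒᵖ X]
    {I : InjectiveResolution X} (hI : IsMinimalResolution I) (n : ℕ) :
    Module.Finite Aᵐᵒᵖ (cosyzygy I n) ∧ Module.Finite Aᵐᵒᵖ (I.cocomplex.X n) := by
  have key : ∀ i, Module.Finite Aᵐᵒᵖ (cosyzygy I i) → Module.Finite Aᵐᵒᵖ (I.cocomplex.X i) := by
    intro i _
    refine finite_of_essential K (f := (cosyzygy I i).subtype) Subtype.val_injective ?_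
    rw [Submodule.range_subtype]
    exact hI i
  suffices h : Module.Finite Aᵐᵒᵖ (cosyzygy I n) from ⟨h, key n h⟩
  induction n with
  | zero => exact Module.Finite.equiv I.cosyzygyZeroEquiv
  | succ n ih =>
    have := key n ih
    exact Module.Finite.of_surjective _ (I.toCosyzygy_surjective n)

end Finiteness

/-! ### The cogenerator argument and the conclusion. -/

theorem LinearMap.eq_zero_of_projective {R : Type*} [Ring R] {Y P : Type*} [AddCommGroup Y]
    [AddCommGroup P] [Module R Y] [Module R P] [Module.Projective R P]
    (h : ∀ f : Y →ₗ[R] R, f = 0) (g : Y →ₗ[R] P) : g = 0 := by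
  obtain ⟨s, hs⟩ := Module.projective_def.1 (‹Module.Projective R P›)
  have hsi : Function.Injective s := hs.injective
  ext y
  refine hsi (Finsupp.ext fun p => ?_)
  simpa using LinearMap.congr_fun (h (Finsupp.lapply p ∘ₗ s ∘ₗ g)) y

/-- For an algebra of finite Gorenstein dimension whose minimal injective resolution has projective
terms before the last one, the sum of the first and the last term is an injective cogenerator. -/
theorem smallDual_isFiniteSummand {K : Type u} [Field K] {A : Type v} [Ring A] [Algebra K A]
    [FiniteDimensional K A] {n : ℕ} {I : InjectiveResolution (rightRegular A)}
    (hproj : ∀ i < n, Module.Projective Aᵐᵒᵖ (I.cocomplex.X i))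
    (hC : Module.Injective Aᵐᵒᵖ (cosyzygy I n)) {d : ℕ}
    (hd : HasProjectiveDimensionLT (ModuleCat.of Aᵐᵒᵖ (SmallDual K A)) (d + 1)) :
    IsFiniteSummand Aᵐᵒᵖ (SmallDual K A) (I.cocomplex.X 0 × cosyzygy I n) := by
  have : IsNoetherianRing Aᵐᵒᵖ := IsNoetherianRing.of_finite K Aᵐᵒᵖ
  have : IsArtinianRing Aᵐᵒᵖ := IsArtinianRing.of_finite K Aᵐᵒᵖ
  have := I.moduleInjective 0
  have : Module.Injective Aᵐᵒᵖ (I.cocomplex.X 0 × cosyzygy I n) := Module.Injective.prod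
  obtain ⟨k, f, hf⟩ := exists_embedding_pi (R := Aᵐᵒᵖ) (N := SmallDual K A)
    (M := I.cocomplex.X 0 × cosyzygy I n) (by
      intro T hT
      have h0 : ∀ g : T →ₗ[Aᵐᵒᵖ] I.cocomplex.X 0, g = 0 := fun g => by
        ext x
        exact congrArg Prod.fst (LinearMap.congr_fun (hT (LinearMap.inl _ _ _ ∘ₗ g)) x)
      have hn : ∀ g : T →ₗ[Aᵐᵒᵖ] cosyzygy I n, g = 0 := fun g => by
        ext1 x
        exact congrArg Prod.snd (LinearMap.congr_fun (hT (LinearMap.inr _ _ _ ∘ₗ g)) x)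
      -- `A` embeds in `I₀` by the coaugmentation.
      have hA : ∀ g : T →ₗ[Aᵐᵒᵖ] Aᵐᵒᵖ, g = 0 := fun g => by
        ext1 x
        have h1 := LinearMap.congr_fun
          (h0 (I.coaugmentation ∘ₗ (opRegularEquiv A).toLinearMap ∘ₗ g)) x
        exact (opRegularEquiv A).injective (I.coaugmentation_injective
          (h1.trans (map_zero (I.coaugmentation ∘ₗ (opRegularEquiv A).toLinearMap)).symm))
      have hE : ExtVanishes (ModuleCat.of Aᵐᵒᵖ T) (rightRegular A) :=
        ExtVanishes.of_injectiveResolution I (hC := hC) hn fun i hi g => by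
          have := hproj i hi
          exact LinearMap.eq_zero_of_projective hA g
      have hD := ExtVanishes.of_hasProjectiveDimensionLT
        (hE.of_linearEquiv (X' := ModuleCat.of Aᵐᵒᵖ Aᵐᵒᵖ) (opRegularEquiv A)) hd
      -- The inclusion of `T` is itself an element of the vanishing $\mathrm{Ext}^0(T,D(A))$.
      have h1 : T.subtype = 0 := hD.hom_eq_zero T.subtype
      rw [← Submodule.range_subtype T, h1, LinearMap.range_zero])
  exact (Module.Injective.isRetract f hf).isFiniteSummand

theorem mainTheorem3 {K : Type u} [Field K] {A : Type v} [Ring A] [Algebra K A]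
    [FiniteDimensional K A] (n : ℕ) (hn : 2 ≤ n)
    (hdom : algebraDominantDimension A = (n : ℕ∞))
    (hgor : gorensteinDimension K A = (algebraDominantDimension A : WithBot ℕ∞))
    (I : InjectiveResolution (rightRegular A)) (hI : IsMinimalResolution I) :
    algebraDominantDimension
      (Module.End Aᵐᵒᵖ ((I.cocomplex.X 0 : ModuleCat Aᵐᵒᵖ) × cosyzygy I n)) = (n : ℕ∞) := by
  rw [hdom] at hgor
  -- Otherwise the Gorenstein dimension would be `⊤`, not the finite `n`.
  have hG : IsGorensteinAlgebra K A := by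
    by_contra h
    rw [gorensteinDimension, if_neg h] at hgor
    have : (⊤ : ℕ∞) = n := WithBot.coe_injective hgor
    exact ENat.top_ne_natCast n this
  rw [gorensteinDimension, if_pos hG] at hgor
  have hinj : HasInjectiveDimensionLT (rightRegular A) (n + 1) :=
    (injectiveDimension_le_iff _ n).1 hgor.le
  have hpd : HasProjectiveDimensionLE (ModuleCat.of Aᵐᵒᵖ (RegularDual K A)) n :=
    (projectiveDimension_le_iff _ n).1 (hG.1 ▸ hgor.le)
  have hpd' : HasProjectiveDimensionLE (ModuleCat.of Aᵐᵒᵖ (SmallDual K A)) n :=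
    ModuleCat.hasProjectiveDimensionLE_of_linearEquiv.{max u v, v}
      (M := ModuleCat.of Aᵐᵒᵖ (RegularDual K A)) (N := ModuleCat.of Aᵐᵒᵖ (SmallDual K A))
      (smallDualEquiv K A).symm n
  have hproj := hI.projective ((natCast_le_dominantDimension_iff n (rightRegular A)).1 hdom.ge)
  have hC := I.cosyzygy_injective hinj
  have := I.moduleInjective 0
  have hM : Module.Injective Aᵐᵒᵖ (I.cocomplex.X 0 × cosyzygy I n) := Module.Injective.prod
  have : Module.Finite Aᵐᵒᵖ (rightRegular A) := Module.Finite.equiv (opRegularEquiv A)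
  have := (IsMinimalResolution.finite K hI 0).2
  have := (IsMinimalResolution.finite K hI n).1
  have hNM := smallDual_isFiniteSummand hproj hC hpd'
  -- Conversely, the module is finitely generated and injective, so it splits off a power of $D(A)$.
  obtain ⟨k, f, hf⟩ := exists_embedding_smallDual K A (I.cocomplex.X 0 × cosyzygy I n)
  have hMN := (Module.Injective.isRetract f hf).isFiniteSummand
  rw [algebraDominantDimension_moduleEnd hNM hMN,
    ← algebraDominantDimension_eq_of_ringEquiv (smallDualEndEquiv K A), hdom]
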